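/- Let $(X,\tau)$ be a locally convex space over $\mathbb{R}$ or $\mathbb{C}$ (Hausdorff or not) with continuous dual $X'$. Suppose that $X$ is of type A, that is, (a) every $\tau$-Cauchy sequence in $X$ converges, and (b) every $\sigma(X',X)$-compact subset of $X'$ is equicontinuous on $(X,\tau)$. Let $\{T(t)\}_{t\ge 0}$ be a semigroup of $\tau$-continuous linear operators on $X$, that is, $T(0)=\mathbb{1}$ and $T(t)T(s)=T(t+s)$ for all $s,t\ge 0$. Then the following are equivalent: (i) $\{T(t)\}_{t\ge 0}$ is strongly continuous: for every $x\in X$ the map $t\mapsto T(t)x$ from $[0,\infty)$ to $(X,\tau)$ is continuous. (ii) $\{T(t)\}_{t\ge 0}$ is weakly continuous, that is, for all $x\in X$ and $x'\in X'$ the scalar function $t\mapsto \langle T(t)x,x'\rangle$ is continuous on $[0,\infty)$; and it is locally equicontinuous, that is, for every $t\ge 0$ and every $\tau$-continuous seminorm $p$ on $X$ there is a $\tau$-continuous seminorm $q$ on $X$ such that $\sup_{0\le s\le t}p(T(s)x)\le q(x)$ for every $x\in X$. -/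

import Mathlib

open scoped NNReal

/-- Type A: every Cauchy sequence converges, and every weak-* compact subset of the continuous
dual is equicontinuous on the space. -/
structure IsTypeA (𝕜 X : Type*) [RCLike 𝕜] [AddCommGroup X] [Module 𝕜 X] [UniformSpace X] :
    Prop where
  seqComplete : ∀ u : ℕ → X, CauchySeq u → ∃ x : X, Filter.Tendsto u Filter.atTop (nhds x)
  equicontinuous_of_isCompact : ∀ K : Set (WeakDual 𝕜 X), IsCompact K →
    Equicontinuous (fun (φ : K) (x : X) => (φ : WeakDual 𝕜 X) x)

section Semigroup

variable {𝕜 X : Type*} [RCLike 𝕜] [AddCommGroup X] [Module 𝕜 X] [TopologicalSpace X]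

/-- A one-parameter semigroup of continuous linear operators. -/
structure IsOperatorSemigroup (T : ℝ≥0 → X →L[𝕜] X) : Prop where
  map_zero : T 0 = ContinuousLinearMap.id 𝕜 X
  map_add : ∀ s t : ℝ≥0, T (t + s) = (T t).comp (T s)

/-- All orbits are continuous. -/
def IsStronglyContinuous (T : ℝ≥0 → X →L[𝕜] X) : Prop :=
  ∀ x : X, Continuous (fun t : ℝ≥0 => T t x)

/-- All orbits are continuous when tested against continuous linear functionals. -/
def IsWeaklyContinuous (T : ℝ≥0 → X →L[𝕜] X) : Prop :=
  ∀ (x : X) (φ : X →L[𝕜] 𝕜), Continuous (fun t : ℝ≥0 => φ (T t x))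

/-- For every `t` and every continuous seminorm `p` there is a continuous seminorm `q` with
`sup_{s ≤ t} p (T s x) ≤ q x` for all `x`. -/
def IsLocallyEquicontinuous (T : ℝ≥0 → X →L[𝕜] X) : Prop :=
  ∀ (t : ℝ≥0) (p : Seminorm 𝕜 X), Continuous p →
    ∃ q : Seminorm 𝕜 X, Continuous q ∧ ∀ s ≤ t, ∀ x : X, p (T s x) ≤ q x

end Semigroup

/-! Strong to weak: the functionals `φ ∘ T s` with `s ≤ t` and `|φ| ≤ p` are a continuous image of
`[0, t]` times a polar, which is compact by Banach-Alaoglu. Type A makes them equicontinuous, hence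
dominated by one seminorm `q`, and Hahn-Banach recovers `p (T s x)` as a value `|φ (T s x)|`.

Weak to strong: closed convex sets are weakly closed, so a weakly continuous orbit has separable
range, and closed seminorm balls pull back to closed sets of times. Baire gives an interval before
`t` on which the orbit oscillates little; the semigroup law and local equicontinuity carry this
forward to `t > 0`. At `0`, the vectors with `T t y → y` form a closed convex set containing `T s x`
for `s > 0`, hence also their weak limit `x`. -/

open Filter Topology Set TopologicalSpace

section LocallyConvex

variable {𝕜 X : Type*} [RCLike 𝕜] [AddCommGroup X] [Module 𝕜 X]

/-- The **Banach-Alaoglu theorem** for the polar of a continuous seminorm on a topological vector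
space over a field satisfying `RCLike`. -/
theorem WeakDual.isCompact_setOf_norm_le_seminorm [TopologicalSpace X] [PolynormableSpace 𝕜 X]
    {p : Seminorm 𝕜 X} (hp : Continuous p) :
    IsCompact {φ : WeakDual 𝕜 X | ∀ x, ‖φ x‖ ≤ p x} := by
  have hind : IsInducing (fun (φ : WeakDual 𝕜 X) (x : X) => φ x) := ⟨rfl⟩
  -- Continuity need not be imposed on the right: a linear map dominated by `p` is continuous.
  have himage : (fun (φ : WeakDual 𝕜 X) (x : X) => φ x) '' {φ | ∀ x, ‖φ x‖ ≤ p x} =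
      range ((↑) : (X →ₗ[𝕜] 𝕜) → X → 𝕜) ∩
        univ.pi fun x => Metric.closedBall (0 : 𝕜) (p x) := by
    ext f
    constructor
    · rintro ⟨φ, hφ, rfl⟩
      exact ⟨⟨(WeakDual.toStrongDual φ).toLinearMap, rfl⟩, fun x _ => by simpa using hφ x⟩
    · rintro ⟨⟨l, rfl⟩, hl⟩
      have hbound : ∀ x, ‖l x‖ ≤ p x := fun x => by simpa using hl x (mem_univ x)
      have hcont : Continuous l :=
        (PolynormableSpace.withSeminorms 𝕜 X).continuous_normedSpace_rng 𝕜 l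
          ⟨{⟨p, hp⟩}, 1, fun x => by simpa using hbound x⟩
      exact ⟨StrongDual.toWeakDual ⟨l, hcont⟩, hbound, rfl⟩
  have hclosed : IsClosed (range ((↑) : (X →ₗ[𝕜] 𝕜) → X → 𝕜)) :=
    LinearMap.isClosed_range_coe X 𝕜 (RingHom.id 𝕜)
  have hcompact : IsCompact (univ.pi fun x => Metric.closedBall (0 : 𝕜) (p x)) :=
    isCompact_univ_pi fun x => ProperSpace.isCompact_closedBall (0 : 𝕜) (p x)
  rw [hind.isCompact_iff, himage]
  exact hcompact.inter_left hclosed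

/-- A continuous seminorm is attained by a continuous functional it dominates. -/
theorem Seminorm.exists_strongDual_norm_eq [TopologicalSpace X] [PolynormableSpace 𝕜 X]
    {p : Seminorm 𝕜 X} (hp : Continuous p) (x : X) :
    ∃ φ : StrongDual 𝕜 X, (∀ y, ‖φ y‖ ≤ p y) ∧ ‖φ x‖ = p x := by
  by_cases hx : p x = 0
  · exact ⟨0, fun y => by simp, by simp [hx]⟩
  have hx0 : x ≠ 0 := fun h => hx (by simp [h])
  -- The functional to extend is `c • x ↦ p x * c` on the line through `x`.
  let e := LinearEquiv.toSpanNonzeroSingleton 𝕜 X x hx0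
  have he : ∀ c : 𝕜, ((((p x : ℝ) : 𝕜) • e.symm.toLinearMap) (e c)) = (p x : 𝕜) * c := fun c => by
    rw [LinearMap.smul_apply, LinearEquiv.coe_coe, e.symm_apply_apply, smul_eq_mul]
  have he' : ∀ c : 𝕜, (e c : X) = c • x := fun _ => rfl
  obtain ⟨φ, hφ, hle⟩ := Module.Dual.exists_continuous_extension_of_le_seminorm (𝕜 := 𝕜)
    (Submodule.span 𝕜 {x}) (((p x : ℝ) : 𝕜) • e.symm.toLinearMap) hp (fun y => by
      obtain ⟨c, rfl⟩ := e.surjective y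
      rw [he, he', map_smul_eq_mul, norm_mul, RCLike.norm_ofReal,
        abs_of_nonneg (apply_nonneg p x), mul_comm])
  refine ⟨φ, hle, ?_⟩
  have h := hφ (e 1)
  rw [he, he', one_smul, mul_one] at h
  rw [h, RCLike.norm_ofReal, abs_of_nonneg (apply_nonneg p x)]

variable [Module ℝ X] [IsScalarTower ℝ 𝕜 X] [TopologicalSpace X] [IsTopologicalAddGroup X]
  [ContinuousSMul 𝕜 X] [LocallyConvexSpace ℝ X]

open scoped ComplexOrder in
/-- A space over a field satisfying `RCLike` that is locally convex over `ℝ` is polynormable. -/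
theorem PolynormableSpace.of_locallyConvexSpace_real : PolynormableSpace 𝕜 X := by
  have : ContinuousSMul ℝ X := IsScalarTower.continuousSMul (M := ℝ) (α := X) 𝕜
  have : LocallyConvexSpace 𝕜 X :=
    .ofBasisZero 𝕜 X _ _ (LocallyConvexSpace.convex_basis_zero ℝ X) fun _ hs =>
      convex_of_nonneg_surjective_algebraMap _ (fun _ => RCLike.nonneg_iff_exists_ofReal.mp) hs.2
  exact LocallyConvexSpace.toPolynormableSpace

/-- Closed convex sets are stable under weak limits. -/
theorem Convex.mem_of_tendsto_strongDual {ι : Type*} {l : Filter ι} [l.NeBot] {f : ι → X} {x : X}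
    {s : Set X} (hs : Convex ℝ s) (hs' : IsClosed s)
    (hf : ∀ φ : X →L[𝕜] 𝕜, Tendsto (fun i => φ (f i)) l (𝓝 (φ x)))
    (hmem : ∃ᶠ i in l, f i ∈ s) : x ∈ s := by
  by_contra hx
  obtain ⟨φ, u, hu, hs⟩ := RCLike.geometric_hahn_banach_point_closed (𝕜 := 𝕜) hs hs' hx
  have h : ∀ᶠ i in l, RCLike.re (φ (f i)) < u :=
    ((RCLike.continuous_re.tendsto _).comp (hf φ)).eventually_lt_const hu
  obtain ⟨i, hi, hi'⟩ := (hmem.and_eventually h).exists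
  exact lt_asymm hi' (hs _ hi)

/-- Closed convex sets have closed preimage under weakly continuous maps. -/
theorem Convex.isClosed_preimage_of_strongDual {Y : Type*} [TopologicalSpace Y] {f : Y → X}
    (hf : ∀ φ : X →L[𝕜] 𝕜, Continuous fun y => φ (f y)) {s : Set X} (hs : Convex ℝ s)
    (hs' : IsClosed s) : IsClosed (f ⁻¹' s) := by
  rw [isClosed_iff_frequently]
  exact fun y hy => hs.mem_of_tendsto_strongDual hs' (fun φ => (hf φ).tendsto y) hy

/-- A weakly continuous map from a separable space has separable range. -/
theorem TopologicalSpace.isSeparable_range_of_strongDual {Y : Type*} [TopologicalSpace Y]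
    [SeparableSpace Y] {f : Y → X} (hf : ∀ φ : X →L[𝕜] 𝕜, Continuous fun y => φ (f y)) :
    IsSeparable (range f) := by
  have : ContinuousSMul ℝ X := IsScalarTower.continuousSMul (M := ℝ) (α := X) 𝕜
  obtain ⟨D, hD, hDd⟩ := exists_countable_dense Y
  let S := (Submodule.span ℝ (f '' D)).topologicalClosure
  have hclosed : IsClosed (f ⁻¹' S) :=
    S.convex.isClosed_preimage_of_strongDual hf (Submodule.isClosed_topologicalClosure _)
  have hsub : D ⊆ f ⁻¹' S := fun y hy =>
    Submodule.le_topologicalClosure _ (Submodule.subset_span (mem_image_of_mem f hy))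
  have hsep : IsSeparable (S : Set X) := by
    rw [Submodule.topologicalClosure_coe]
    exact ((hD.image f).isSeparable.span (R := ℝ)).closure
  refine hsep.mono ?_
  rintro _ ⟨y, rfl⟩
  exact hclosed.closure_subset_iff.2 hsub (hDd y)

/-- A weakly continuous map on a separable Baire space has arbitrarily small oscillation, with
respect to any continuous seminorm, on some nonempty open subset of each nonempty open set. -/
theorem Seminorm.exists_isOpen_sub_le_of_strongDual {Y : Type*} [TopologicalSpace Y] [BaireSpace Y]
    [SeparableSpace Y] {f : Y → X} (hf : ∀ φ : X →L[𝕜] 𝕜, Continuous fun y => φ (f y))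
    {p : Seminorm 𝕜 X} (hp : Continuous p) {ε : ℝ} (hε : 0 < ε) {U : Set Y} (hU : IsOpen U)
    (hU' : U.Nonempty) :
    ∃ V ⊆ U, IsOpen V ∧ V.Nonempty ∧ ∀ y ∈ V, ∀ z ∈ V, p (f y - f z) ≤ ε := by
  obtain ⟨C, hC, hCf⟩ := TopologicalSpace.isSeparable_range_of_strongDual hf
  have := hC.to_subtype
  -- Radius `ε / 2`, so that two points of the same ball differ by at most `ε`.
  let F : C → Set Y := fun c => f ⁻¹' p.closedBall c (ε / 2)
  have hF : ∀ c, IsClosed (F c) := fun c =>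
    ((p.convex_closedBall (c : X) (ε / 2))).isClosed_preimage_of_strongDual hf (by
      have : p.closedBall (c : X) (ε / 2) = (fun x => p (x - c)) ⁻¹' Iic (ε / 2) := by
        ext; simp [Seminorm.mem_closedBall]
      rw [this]
      exact isClosed_Iic.preimage (hp.comp (continuous_id.sub continuous_const)))
  have hcover : ⋃ c, F c = univ := by
    refine eq_univ_of_forall fun y => ?_
    have hopen : IsOpen {x | p (f y - x) < ε / 2} :=
      isOpen_lt (hp.comp (continuous_const.sub continuous_id)) continuous_const
    obtain ⟨c, hc, hcC⟩ := mem_closure_iff.1 (hCf (mem_range_self y)) _ hopen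
      (by simpa using half_pos hε)
    exact mem_iUnion.2 ⟨⟨c, hcC⟩, p.mem_closedBall.2 (le_of_lt hc)⟩
  obtain ⟨y, hyU, hy⟩ := (dense_iUnion_interior_of_closed hF hcover).inter_open_nonempty U hU hU'
  obtain ⟨c, hc⟩ := mem_iUnion.1 hy
  refine ⟨U ∩ interior (F c), inter_subset_left, hU.inter isOpen_interior, ⟨y, hyU, hc⟩, ?_⟩
  rintro a ⟨-, ha⟩ b ⟨-, hb⟩
  have ha' : p (f a - c) ≤ ε / 2 := p.mem_closedBall.1 (interior_subset (s := F c) ha)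
  have hb' : p (f b - c) ≤ ε / 2 := p.mem_closedBall.1 (interior_subset (s := F c) hb)
  calc p (f a - f b) = p ((f a - c) - (f b - c)) := by rw [sub_sub_sub_cancel_right]
    _ ≤ p (f a - c) + p (f b - c) := map_sub_le_add p _ _
    _ ≤ ε := by linarith

end LocallyConvex

section Semigroup

variable {𝕜 X : Type*} [RCLike 𝕜] [AddCommGroup X] [Module 𝕜 X]

/-- On a space whose weak-* compact subsets of the dual are equicontinuous, strongly continuous
families of operators are locally equicontinuous. -/
theorem IsStronglyContinuous.isLocallyEquicontinuous [UniformSpace X] [IsUniformAddGroup X]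
    [ContinuousSMul 𝕜 X] [PolynormableSpace 𝕜 X]
    (hX : ∀ K : Set (WeakDual 𝕜 X), IsCompact K →
      Equicontinuous (fun (φ : K) (x : X) => (φ : WeakDual 𝕜 X) x))
    {T : ℝ≥0 → X →L[𝕜] X} (hT : IsStronglyContinuous T) : IsLocallyEquicontinuous T := by
  intro t p hp
  let B : Set (WeakDual 𝕜 X) := {φ | ∀ x, ‖φ x‖ ≤ p x}
  have hB : CompactSpace B :=
    isCompact_iff_compactSpace.1 (WeakDual.isCompact_setOf_norm_le_seminorm hp)
  let Φ : Icc (0 : ℝ≥0) t × B → WeakDual 𝕜 X := fun a =>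
    StrongDual.toWeakDual ((WeakDual.toStrongDual a.2.1).comp (T a.1))
  have hΦ : Continuous Φ := by
    refine WeakDual.continuous_of_continuous_eval fun x => ?_
    refine continuous_iff_continuousAt.2 fun a => ?_
    -- Joint continuity: the bound `|φ| ≤ p` is uniform in `φ`, so moving the time costs at most `p
    -- (T s x - T s₀ x)`; moving `φ` is then evaluation at a fixed vector.
    have h1 : Tendsto (fun b : Icc (0 : ℝ≥0) t × B => (b.2 : WeakDual 𝕜 X) (T b.1 x - T a.1 x))
        (𝓝 a) (𝓝 0) := by
      refine squeeze_zero_norm (a := fun b => p (T b.1 x - T a.1 x)) (fun b => b.2.2 _) ?_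
      have : Continuous fun b : Icc (0 : ℝ≥0) t × B => p (T b.1 x - T a.1 x) :=
        hp.comp (((hT x).comp (continuous_subtype_val.comp continuous_fst)).sub continuous_const)
      simpa using this.tendsto a
    have h2 : Tendsto (fun b : Icc (0 : ℝ≥0) t × B => (b.2 : WeakDual 𝕜 X) (T a.1 x))
        (𝓝 a) (𝓝 ((a.2 : WeakDual 𝕜 X) (T a.1 x))) :=
      ((WeakDual.eval_continuous (T a.1 x)).comp
        (continuous_subtype_val.comp continuous_snd)).tendsto a
    have h3 := h1.add h2
    simp only [map_sub, sub_add_cancel, zero_add] at h3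
    exact h3
  have hK := hX _ (isCompact_range hΦ)
  -- The final `0` is the index of the norm of `𝕜`, the only member of its seminorm family.
  obtain ⟨q, hq, hle⟩ := (((norm_withSeminorms 𝕜 𝕜).equicontinuous_TFAE
    (fun φ : range Φ => (WeakDual.toStrongDual (φ : WeakDual 𝕜 X)).toLinearMap)).out 1 3
    rfl rfl).1 hK 0
  refine ⟨q, hq, fun s hs x => ?_⟩
  obtain ⟨φ, hφ, hφx⟩ := Seminorm.exists_strongDual_norm_eq hp (T s x)
  rw [← hφx]
  exact hle ⟨_, mem_range_self (⟨s, zero_le, hs⟩, ⟨StrongDual.toWeakDual φ, hφ⟩)⟩ x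

variable [Module ℝ X] [IsScalarTower ℝ 𝕜 X] [TopologicalSpace X] [IsTopologicalAddGroup X]
  [ContinuousSMul 𝕜 X] [LocallyConvexSpace ℝ X]

/-- Orbits of weakly continuous, locally equicontinuous semigroups are continuous at positive
times. -/
theorem IsOperatorSemigroup.continuousAt_of_pos {T : ℝ≥0 → X →L[𝕜] X} (hT : IsOperatorSemigroup T)
    (hw : IsWeaklyContinuous T) (he : IsLocallyEquicontinuous T) (x : X) {t : ℝ≥0} (ht : 0 < t) :
    ContinuousAt (fun t => T t x) t := by
  have : PolynormableSpace 𝕜 X := .of_locallyConvexSpace_real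
  refine ((PolynormableSpace.withSeminorms 𝕜 X).tendsto_nhds _ _).2 fun ⟨p, hp⟩ ε hε => ?_
  obtain ⟨q, hq, hpq⟩ := he t p hp
  obtain ⟨V, hVt, hV, ⟨u, hu⟩, hVq⟩ := Seminorm.exists_isOpen_sub_le_of_strongDual (hw x) hq
    (half_pos hε) isOpen_Ioo (nonempty_Ioo.2 ht)
  obtain ⟨hu0, hut⟩ := hVt hu
  have hsub : Tendsto (fun s => s - (t - u)) (𝓝 t) (𝓝 u) := by
    have : Continuous fun s : ℝ≥0 => s - (t - u) := continuous_id.sub continuous_const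
    simpa [tsub_tsub_cancel_of_le hut.le] using this.tendsto t
  -- Requiring `s > t - u` makes the truncated subtraction in `ℝ≥0` genuine, so that `T s` factors
  -- through `T (t - u)`.
  filter_upwards [hsub (hV.mem_nhds hu), Ioi_mem_nhds (tsub_lt_self ht hu0)] with s hs hs'
  have h1 : T s x = T (t - u) (T (s - (t - u)) x) := by
    rw [← ContinuousLinearMap.comp_apply, ← hT.map_add, add_tsub_cancel_of_le (le_of_lt hs')]
  have h2 : T t x = T (t - u) (T u x) := by
    rw [← ContinuousLinearMap.comp_apply, ← hT.map_add, tsub_add_cancel_of_le hut.le]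
  change p (T s x - T t x) < ε
  rw [h1, h2, ← map_sub]
  calc _ ≤ q _ := hpq _ tsub_le_self _
    _ ≤ ε / 2 := hVq _ hs _ hu
    _ < ε := half_lt_self hε

/-- The vectors whose orbits under an equicontinuous family of operators converge to them at zero
form a closed set. -/
theorem IsLocallyEquicontinuous.isClosed_setOf_tendsto {T : ℝ≥0 → X →L[𝕜] X}
    (he : IsLocallyEquicontinuous T) :
    IsClosed {x : X | Tendsto (fun t => T t x) (𝓝 0) (𝓝 x)} := by
  have : PolynormableSpace 𝕜 X := .of_locallyConvexSpace_real
  rw [← closure_subset_iff_isClosed]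
  intro x hx
  refine ((PolynormableSpace.withSeminorms 𝕜 X).tendsto_nhds _ _).2 fun ⟨p, hp⟩ ε hε => ?_
  obtain ⟨q, hq, hpq⟩ := he 1 p hp
  -- Here `p` controls `x - y` itself and `q` controls its image under `T t` for `t ≤ 1`.
  have hopen : IsOpen {y | (p + q) (x - y) < ε / 2} :=
    isOpen_lt ((hp.add hq).comp (continuous_const.sub continuous_id)) continuous_const
  obtain ⟨y, hy, hyT⟩ := mem_closure_iff.1 hx _ hopen (by simpa using half_pos hε)
  have hy' : p (x - y) + q (x - y) < ε / 2 := hy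
  have hyp := ((PolynormableSpace.withSeminorms 𝕜 X).tendsto_nhds _ _).1 hyT ⟨p, hp⟩ _ (half_pos hε)
  filter_upwards [hyp, Iio_mem_nhds zero_lt_one] with t ht ht1
  change p (T t x - x) < ε
  replace ht : p (T t y - y) < ε / 2 := ht
  have h := hpq t (le_of_lt ht1) (x - y)
  calc p (T t x - x) = p (T t (x - y) + (T t y - y) - (x - y)) := by
        congr 1; rw [map_sub]; abel
    _ ≤ p (T t (x - y)) + p (T t y - y) + p (x - y) :=
        (map_sub_le_add p _ _).trans (by gcongr; exact map_add_le_add p _ _)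
    _ < ε := by linarith

/-- Weakly continuous, locally equicontinuous semigroups are strongly continuous. -/
theorem IsOperatorSemigroup.isStronglyContinuous {T : ℝ≥0 → X →L[𝕜] X}
    (hT : IsOperatorSemigroup T) (hw : IsWeaklyContinuous T) (he : IsLocallyEquicontinuous T) :
    IsStronglyContinuous T := by
  have : ContinuousSMul ℝ X := IsScalarTower.continuousSMul (M := ℝ) (α := X) 𝕜
  let S : Set X := {x : X | Tendsto (fun t => T t x) (𝓝 0) (𝓝 x)}
  have hS : Convex ℝ S := by
    intro x hx y hy a b _ _ _
    have h : Tendsto (fun t => a • T t x + b • T t y) (𝓝 0) (𝓝 (a • x + b • y)) :=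
      (Tendsto.const_smul hx a).add (Tendsto.const_smul hy b)
    have hreal : ∀ t (c : ℝ) z, T t (c • z) = c • T t z := fun t c z => by
      rw [← algebraMap_smul 𝕜 c z, map_smul, algebraMap_smul]
    have hcomb : ∀ t, T t (a • x + b • y) = a • T t x + b • T t y := fun t => by
      rw [_root_.map_add, hreal, hreal]
    change Tendsto (fun t => T t (a • x + b • y)) (𝓝 0) (𝓝 (a • x + b • y))
    simpa only [hcomb] using h
  intro x
  refine continuous_iff_continuousAt.2 fun t => ?_
  rcases eq_or_ne t 0 with rfl | ht
  · have hx : x ∈ S := by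
      -- The limit is taken over `s > 0` because only there does continuity of the orbit at `s` give
      -- `T s x ∈ S`.
      refine hS.mem_of_tendsto_strongDual (𝕜 := 𝕜) (l := 𝓝[>] (0 : ℝ≥0)) (f := fun s => T s x)
        he.isClosed_setOf_tendsto (fun φ => ?_) (Eventually.frequently ?_)
      · have h := (hw x φ).tendsto 0
        simp only [hT.map_zero, ContinuousLinearMap.id_apply] at h
        exact h.mono_left nhdsWithin_le_nhds
      · filter_upwards [self_mem_nhdsWithin] with s hs
        have h := (hT.continuousAt_of_pos hw he x hs).tendsto
        have hadd : Tendsto (fun t => t + s) (𝓝 0) (𝓝 s) := by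
          have : Continuous fun t => t + s := continuous_id.add continuous_const
          simpa using this.tendsto 0
        refine (h.comp hadd).congr fun r => ?_
        simp [hT.map_add]
    change Tendsto _ _ (𝓝 (T 0 x))
    rw [hT.map_zero]
    exact hx
  · exact hT.continuousAt_of_pos hw he x (pos_iff_ne_zero.2 ht)

end Semigroup

theorem mainTheorem3 {𝕜 X : Type*} [RCLike 𝕜]
    [AddCommGroup X] [Module 𝕜 X] [Module ℝ X] [IsScalarTower ℝ 𝕜 X]
    [UniformSpace X] [IsUniformAddGroup X] [ContinuousSMul 𝕜 X] [LocallyConvexSpace ℝ X]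
    (hX : IsTypeA 𝕜 X) (T : ℝ≥0 → X →L[𝕜] X) (hT : IsOperatorSemigroup T) :
    IsStronglyContinuous T ↔ IsWeaklyContinuous T ∧ IsLocallyEquicontinuous T := by
  have : PolynormableSpace 𝕜 X := .of_locallyConvexSpace_real
  refine ⟨fun h => ⟨fun x φ => φ.continuous.comp (h x), ?_⟩, fun h => ?_⟩
  · exact h.isLocallyEquicontinuous hX.equicontinuous_of_isCompact
  · exact hT.isStronglyContinuous h.1 h.2
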